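/- For real $\nu$ and $x>0$ let $K_\nu(x)=\int_0^\infty e^{-x\cosh t}\cosh(\nu t)\,dt$ be the modified Bessel function of the second kind. Let $n\in\mathbb{N}=\{0,1,2,\ldots\}$. For every real $\nu\ge -\tfrac12$ the function $x\mapsto x^{-\nu}K_\nu(x)$ is $n$ times continuously differentiable on $(0,\infty)$, and for each fixed $x>0$, $$\frac{d^{n}}{dx^{n}}\left(\frac{K_{\nu}(x)}{x^{\nu}}\right)\sim(-1)^n\,\frac{K_{\nu+n}(x)}{x^{\nu}}\qquad\text{as } \nu\to\infty \ (\nu \text{ real}),$$ that is, the quotient of the two sides tends to $1$. -/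

import Mathlib

open MeasureTheory Set Filter Asymptotics

/-- The modified Bessel function of the second kind `K_ν(x)` of real order `ν` (the Macdonald
function) for `x > 0`, through its standard integral representation
`K_ν(x) = ∫₀^∞ e^{-x cosh t} cosh(ν t) dt`. For `x ≤ 0` the value has no meaning. -/
noncomputable def besselK (ν x : ℝ) : ℝ :=
  ∫ t in Ioi (0 : ℝ), Real.exp (-x * Real.cosh t) * Real.cosh (ν * t)

/-- For every real order and every `x > 0` the integral that defines `besselK` converges. -/
theorem besselK_integrableOn (ν : ℝ) {x : ℝ} (hx : 0 < x) :
    IntegrableOn (fun t : ℝ => Real.exp (-x * Real.cosh t) * Real.cosh (ν * t)) (Ioi 0) := by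
  have hg : Integrable (fun t : ℝ => Real.exp ((ν ^ 2) / x) * Real.exp (-(x / 4) * t ^ 2)) :=
    (integrable_exp_neg_mul_sq (by positivity)).const_mul _
  refine Integrable.integrableOn (hg.mono' (by fun_prop) (ae_of_all _ fun t => ?_))
  rw [Real.norm_of_nonneg (mul_nonneg (Real.exp_pos _).le (Real.cosh_pos _).le), ← Real.exp_add]
  have h1 : 1 + t ^ 2 / 2 ≤ Real.cosh t := by
    have e : Real.cosh t = 1 + 2 * Real.sinh (t / 2) ^ 2 := by
      have := Real.cosh_two_mul (t / 2)
      rw [Real.cosh_sq, mul_div_cancel₀ t two_ne_zero] at this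
      linarith
    have h : (t / 2) ^ 2 ≤ Real.sinh (t / 2) ^ 2 := by
      rcases le_total 0 (t / 2) with h0 | h0
      · nlinarith [Real.self_le_sinh_iff.2 h0]
      · nlinarith [Real.sinh_le_self_iff.2 h0]
    rw [e]
    nlinarith
  have h2 : Real.cosh (ν * t) ≤ Real.exp |ν * t| := by
    rw [← Real.cosh_abs, Real.cosh_eq]
    have : Real.exp (-|ν * t|) ≤ Real.exp |ν * t| :=
      Real.exp_le_exp.2 (by linarith [abs_nonneg (ν * t)])
    linarith
  calc Real.exp (-x * Real.cosh t) * Real.cosh (ν * t)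
      ≤ Real.exp (-x * Real.cosh t) * Real.exp |ν * t| := by gcongr
    _ = Real.exp (-x * Real.cosh t + |ν * t|) := (Real.exp_add _ _).symm
    _ ≤ _ := by
      apply Real.exp_le_exp.2
      have h3 : x * (1 + t ^ 2 / 2) ≤ x * Real.cosh t := by gcongr
      have h4 : |ν * t| ≤ ν ^ 2 / x + x / 4 * t ^ 2 := by
        have : ν ^ 2 / x + x / 4 * t ^ 2 - |ν| * |t| = (|ν| - x / 2 * |t|) ^ 2 / x := by
          field_simp
          rw [← sq_abs ν, ← sq_abs t]
          ring
        have h5 : 0 ≤ (|ν| - x / 2 * |t|) ^ 2 / x := by positivity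
        rw [abs_mul]
        linarith
      nlinarith [sq_nonneg t, mul_nonneg hx.le (sq_nonneg t)]

/-! Write `g_ν(y) = K_ν(y) / y^ν`. Then `g_ν' = -y g_{ν+1}`, so smoothness follows by induction over
all orders. Leibniz' rule expresses the derivative of order `n + 2` of `g_ν` through those of orders
`n + 1` and `n` of `g_{ν+1}`, whence a two-step induction on `n`. The first term carries the
asymptotics, of size `K_{ν+n+2}`; the second has size `K_{ν+n+1}`, which is negligible by
`besselK_isLittleO_add_one`. -/

theorem besselK_nonneg (ν x : ℝ) : 0 ≤ besselK ν x :=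
  integral_nonneg fun _ => mul_nonneg (Real.exp_pos _).le (Real.cosh_pos _).le

theorem Real.two_mul_cosh_mul_cosh (ν t : ℝ) :
    2 * (Real.cosh t * Real.cosh (ν * t)) =
      Real.cosh ((ν + 1) * t) + Real.cosh ((ν - 1) * t) := by
  rw [add_mul, sub_mul, one_mul, Real.cosh_add, Real.cosh_sub]
  ring

theorem Real.two_mul_sinh_mul_sinh (ν t : ℝ) :
    2 * (Real.sinh t * Real.sinh (ν * t)) =
      Real.cosh ((ν + 1) * t) - Real.cosh ((ν - 1) * t) := by
  rw [add_mul, sub_mul, one_mul, Real.cosh_add, Real.cosh_sub]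
  ring

theorem exp_mul_sinh_integrableOn (ν : ℝ) {x : ℝ} (hx : 0 < x) :
    IntegrableOn (fun t : ℝ => Real.exp (-x * Real.cosh t) * Real.sinh (ν * t)) (Ioi 0) := by
  refine (besselK_integrableOn ν hx).mono' (by fun_prop) (ae_of_all _ fun t => ?_)
  rw [norm_mul, Real.norm_of_nonneg (Real.exp_pos _).le]
  refine mul_le_mul_of_nonneg_left ?_ (Real.exp_pos _).le
  rw [Real.norm_eq_abs, ← sq_le_sq₀ (abs_nonneg _) (Real.cosh_pos _).le, sq_abs, Real.cosh_sq]
  linarith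

/-- The recurrence between three consecutive orders. -/
theorem besselK_recurrence (ν : ℝ) {x : ℝ} (hx : 0 < x) :
    x * (besselK (ν + 1) x - besselK (ν - 1) x) = 2 * ν * besselK ν x := by
  have h1 := besselK_integrableOn (ν + 1) hx
  have h2 := besselK_integrableOn (ν - 1) hx
  have h0 := besselK_integrableOn ν hx
  -- Integrating this derivative over `(0, ∞)` gives the recurrence: the primitive vanishes at `0`,
  -- and at infinity because it and its derivative are integrable.
  have hderiv (t : ℝ) : HasDerivAt (fun t => Real.exp (-x * Real.cosh t) * Real.sinh (ν * t))
      (ν * (Real.exp (-x * Real.cosh t) * Real.cosh (ν * t)) -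
        x / 2 * (Real.exp (-x * Real.cosh t) * Real.cosh ((ν + 1) * t) -
          Real.exp (-x * Real.cosh t) * Real.cosh ((ν - 1) * t))) t := by
    have h := (((Real.hasDerivAt_cosh t).const_mul (-x)).exp).mul
      (((hasDerivAt_id t).const_mul ν).sinh)
    refine h.congr_deriv ?_
    simp only [id_eq, mul_one]
    linear_combination (-x / 2 * Real.exp (-x * Real.cosh t)) * Real.two_mul_sinh_mul_sinh ν t
  have h12 : Integrable (fun t : ℝ => x / 2 * (Real.exp (-x * Real.cosh t) *
      Real.cosh ((ν + 1) * t) - Real.exp (-x * Real.cosh t) * Real.cosh ((ν - 1) * t)))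
      (volume.restrict (Ioi 0)) := (h1.sub h2).const_mul (x / 2)
  have hint : IntegrableOn (fun t : ℝ => ν * (Real.exp (-x * Real.cosh t) * Real.cosh (ν * t)) -
        x / 2 * (Real.exp (-x * Real.cosh t) * Real.cosh ((ν + 1) * t) -
          Real.exp (-x * Real.cosh t) * Real.cosh ((ν - 1) * t))) (Ioi 0) :=
    (Integrable.const_mul h0 ν).sub h12
  have hlim := tendsto_zero_of_hasDerivAt_of_integrableOn_Ioi (fun t _ => hderiv t) hint
    (exp_mul_sinh_integrableOn ν hx)
  have hI := integral_Ioi_of_hasDerivAt_of_tendsto' (fun t _ => hderiv t) hint hlim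
  rw [integral_sub (Integrable.const_mul h0 ν) h12, integral_const_mul,
    integral_const_mul, integral_sub h1 h2] at hI
  simp only [mul_zero, Real.sinh_zero, sub_zero] at hI
  unfold besselK
  linarith

theorem hasDerivAt_besselK (ν : ℝ) {x : ℝ} (hx : 0 < x) :
    HasDerivAt (besselK ν) (-(besselK (ν + 1) x + besselK (ν - 1) x) / 2) x := by
  -- Dominating function for differentiation under the integral: for `y > x / 2` the exponential is
  -- largest at `x / 2`.
  have hb : Integrable (fun t : ℝ => (Real.exp (-(x / 2) * Real.cosh t) * Real.cosh ((ν + 1) * t) +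
      Real.exp (-(x / 2) * Real.cosh t) * Real.cosh ((ν - 1) * t)) / 2)
      (volume.restrict (Ioi 0)) :=
    ((besselK_integrableOn (ν + 1) (half_pos hx)).add
      (besselK_integrableOn (ν - 1) (half_pos hx))).div_const 2
  have h := (hasDerivAt_integral_of_dominated_loc_of_deriv_le (μ := volume.restrict (Ioi (0 : ℝ)))
    (F := fun y t => Real.exp (-y * Real.cosh t) * Real.cosh (ν * t))
    (F' := fun y t => -(Real.exp (-y * Real.cosh t) * Real.cosh ((ν + 1) * t) +
      Real.exp (-y * Real.cosh t) * Real.cosh ((ν - 1) * t)) / 2)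
    (Ioi_mem_nhds (half_lt_self hx)) (Eventually.of_forall fun y => by fun_prop)
    (besselK_integrableOn ν hx) (by fun_prop) (ae_of_all _ fun t y hy => ?_) hb
    (ae_of_all _ fun t y _ => ?_)).2
  · refine h.congr_deriv ?_
    rw [integral_div, integral_neg, integral_add (besselK_integrableOn (ν + 1) hx)
      (besselK_integrableOn (ν - 1) hx)]
    rfl
  · have hc1 := Real.cosh_pos ((ν + 1) * t)
    have hc2 := Real.cosh_pos ((ν - 1) * t)
    have hc := Real.cosh_pos t
    rw [neg_div, norm_neg, Real.norm_of_nonneg (by positivity)]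
    have hy' : x / 2 ≤ y := (mem_Ioi.1 hy).le
    gcongr
  · have hd := (((hasDerivAt_neg y).mul_const (Real.cosh t)).exp).mul_const (Real.cosh (ν * t))
    refine hd.congr_deriv ?_
    linear_combination (-1 / 2 * Real.exp (-y * Real.cosh t)) * Real.two_mul_cosh_mul_cosh ν t

/-- The quotient rule leaves `-(K_{ν+1} + K_{ν-1}) / 2 - ν K_ν / x`, and the recurrence cancels
`K_{ν-1}`. -/
theorem hasDerivAt_besselK_div_rpow (ν : ℝ) {x : ℝ} (hx : 0 < x) :
    HasDerivAt (fun y : ℝ => besselK ν y / y ^ ν)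
      (-(x * (besselK (ν + 1) x / x ^ (ν + 1)))) x := by
  have hp : x ^ ν ≠ 0 := (Real.rpow_pos_of_pos hx ν).ne'
  refine ((hasDerivAt_besselK ν hx).div (Real.hasDerivAt_rpow_const (Or.inl hx.ne'))
    hp).congr_deriv ?_
  rw [Real.rpow_add hx, Real.rpow_sub hx, Real.rpow_one]
  field_simp
  linear_combination besselK_recurrence ν hx

theorem deriv_besselK_div_rpow_eqOn (ν : ℝ) :
    EqOn (deriv fun y : ℝ => besselK ν y / y ^ ν)
      (fun y => -(y * (besselK (ν + 1) y / y ^ (ν + 1)))) (Ioi 0) :=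
  fun _ hy => (hasDerivAt_besselK_div_rpow ν hy).deriv

theorem contDiffOn_besselK_div_rpow (n : ℕ) (ν : ℝ) :
    ContDiffOn ℝ n (fun y : ℝ => besselK ν y / y ^ ν) (Ioi 0) := by
  induction n generalizing ν with
  | zero =>
    exact contDiffOn_zero.2 fun y hy =>
      (hasDerivAt_besselK_div_rpow ν hy).continuousAt.continuousWithinAt
  | succ n ih =>
    rw [Nat.cast_succ, contDiffOn_succ_iff_deriv_of_isOpen isOpen_Ioi]
    refine ⟨fun y hy => (hasDerivAt_besselK_div_rpow ν hy).differentiableAt.differentiableWithinAt,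
      -- The analytic case `ω`, impossible for a natural number.
      fun h => absurd h (by simp), ?_⟩
    exact (contDiffOn_id.mul (ih (ν + 1))).neg.congr (deriv_besselK_div_rpow_eqOn ν)

theorem iteratedDeriv_succ_id_mul {n : ℕ} {g : ℝ → ℝ} {x : ℝ}
    (hg : ContDiffAt ℝ (n + 1 : ℕ) g x) :
    iteratedDeriv (n + 1) (fun y => y * g y) x =
      x * iteratedDeriv (n + 1) g x + (n + 1) * iteratedDeriv n g x := by
  -- Only the Leibniz terms with zero or one derivative on the identity survive; they are split off
  -- the sum.
  rw [iteratedDeriv_fun_mul contDiffAt_fun_id hg, Finset.sum_range_succ', Finset.sum_range_succ']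
  simp [iteratedDeriv_fun_id]
  ring

theorem iteratedDeriv_succ_succ_besselK_div_rpow (n : ℕ) (ν : ℝ) {x : ℝ} (hx : 0 < x) :
    iteratedDeriv (n + 2) (fun y : ℝ => besselK ν y / y ^ ν) x =
      -(x * iteratedDeriv (n + 1) (fun y : ℝ => besselK (ν + 1) y / y ^ (ν + 1)) x) -
        (n + 1) * iteratedDeriv n (fun y : ℝ => besselK (ν + 1) y / y ^ (ν + 1)) x := by
  rw [iteratedDeriv_succ',
    (deriv_besselK_div_rpow_eqOn ν).iteratedDeriv_of_isOpen isOpen_Ioi (n + 1) hx,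
    iteratedDeriv_fun_neg, iteratedDeriv_succ_id_mul
      ((contDiffOn_besselK_div_rpow (n + 1) (ν + 1)).contDiffAt (Ioi_mem_nhds hx))]
  ring

/-- As the order grows, `K_ν(x)` is negligible compared with `K_{ν+1}(x)`. -/
theorem besselK_isLittleO_add_one {x : ℝ} (hx : 0 < x) :
    (fun ν : ℝ => besselK ν x) =o[atTop] fun ν : ℝ => besselK (ν + 1) x := by
  refine isLittleO_iff.2 fun c hc => ?_
  -- Dropping `K_{ν-1} ≥ 0` from the recurrence gives `2ν K_ν ≤ x K_{ν+1}`, so the ratio is at most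
  -- `c` once `x / (2ν) ≤ c`.
  filter_upwards [eventually_ge_atTop (x / (2 * c))] with ν hν
  rw [Real.norm_of_nonneg (besselK_nonneg _ _), Real.norm_of_nonneg (besselK_nonneg _ _)]
  rw [div_le_iff₀ (by positivity)] at hν
  refine le_of_mul_le_mul_left ?_ hx
  calc x * besselK ν x ≤ ν * (2 * c) * besselK ν x :=
        mul_le_mul_of_nonneg_right hν (besselK_nonneg _ _)
    _ = c * (x * (besselK (ν + 1) x - besselK (ν - 1) x)) := by
        rw [besselK_recurrence ν hx]; ring
    _ ≤ x * (c * besselK (ν + 1) x) := by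
        have := mul_nonneg (mul_pos hx hc).le (besselK_nonneg (ν - 1) x)
        linarith

theorem iteratedDeriv_besselK_div_rpow_isEquivalent {x : ℝ} (hx : 0 < x) (n : ℕ) :
    IsEquivalent atTop
      (fun ν : ℝ => iteratedDeriv n (fun y : ℝ => besselK ν y / y ^ ν) x)
      (fun ν : ℝ => (-1) ^ n * (besselK (ν + n) x / x ^ ν)) := by
  have hshift (a : ℝ) : Tendsto (fun ν : ℝ => ν + a) atTop atTop :=
    tendsto_atTop_add_const_right _ a tendsto_id
  induction n using Nat.twoStepInduction with
  | zero => simpa using IsEquivalent.refl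
  | one =>
    refine IsEquivalent.refl.congr_left (Eventually.of_forall fun ν => Eq.symm ?_)
    beta_reduce
    rw [iteratedDeriv_one, (hasDerivAt_besselK_div_rpow ν hx).deriv, Real.rpow_add hx,
      Real.rpow_one]
    push_cast
    field_simp
  | more n ih0 ih1 =>
    have hmain := (IsEquivalent.refl (u := fun _ : ℝ => -x) (l := atTop)).mul
      (ih1.comp_tendsto (hshift 1))
    have htarget : (fun ν : ℝ => (-1) ^ (n + 2) * (besselK (ν + (n + 2 : ℕ)) x / x ^ ν)) =
        (fun _ : ℝ => -x) * ((fun ν : ℝ => (-1) ^ (n + 1) *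
          (besselK (ν + (n + 1 : ℕ)) x / x ^ ν)) ∘ fun ν : ℝ => ν + 1) := by
      funext ν
      simp only [Pi.mul_apply, Function.comp_apply, Real.rpow_add hx, Real.rpow_one]
      rw [show ν + 1 + ((n + 1 : ℕ) : ℝ) = ν + (n + 2 : ℕ) by push_cast; ring]
      field_simp
      ring
    rw [← htarget] at hmain
    have hlo : (fun ν : ℝ => (n + 1 : ℝ) *
        iteratedDeriv n (fun y : ℝ => besselK (ν + 1) y / y ^ (ν + 1)) x) =o[atTop]
        fun ν : ℝ => (-1) ^ (n + 2) * (besselK (ν + (n + 2 : ℕ)) x / x ^ ν) := by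
      refine IsLittleO.const_mul_left ?_ _
      refine (ih0.comp_tendsto (hshift 1)).isBigO.trans_isLittleO ?_
      have hK := (besselK_isLittleO_add_one hx).comp_tendsto (hshift (n + 1))
      -- The shift of `ν` in the power costs only the factor `x⁻¹`, constant in `ν`.
      have hO : (fun ν : ℝ => (-1 : ℝ) ^ n * (x ^ (ν + 1))⁻¹) =O[atTop]
          fun ν : ℝ => (-1 : ℝ) ^ (n + 2) * (x ^ ν)⁻¹ := by
        refine IsBigO.of_bound x⁻¹ (Eventually.of_forall fun ν => ?_)
        simp only [norm_mul, norm_pow, norm_neg, norm_one, one_pow, one_mul, norm_inv,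
          Real.rpow_add hx, Real.rpow_one, Real.norm_of_nonneg hx.le, mul_inv]
        rw [mul_comm]
      refine (hO.mul_isLittleO hK).congr (fun ν => ?_) (fun ν => ?_)
      · simp only [Function.comp_apply]
        rw [show ν + 1 + (n : ℝ) = ν + (n + 1) by ring]
        ring
      · simp only [Function.comp_apply]
        rw [show ν + ((n : ℝ) + 1) + 1 = ν + (n + 2 : ℕ) by push_cast; ring]
        ring
    refine (hmain.sub_isLittleO hlo).congr_left (Eventually.of_forall fun ν => ?_)
    simp only [Pi.sub_apply, Pi.mul_apply, Function.comp_apply,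
      iteratedDeriv_succ_succ_besselK_div_rpow n ν hx]
    ring

theorem corollary3p5 (n : ℕ) (x : ℝ) (hx : 0 < x) :
    (∀ ν : ℝ, -1 / 2 ≤ ν → ContDiffOn ℝ n (fun y : ℝ => besselK ν y / y ^ ν) (Ioi 0)) ∧
    IsEquivalent atTop
      (fun ν : ℝ => iteratedDeriv n (fun y : ℝ => besselK ν y / y ^ ν) x)
      (fun ν : ℝ => (-1) ^ n * (besselK (ν + n) x / x ^ ν)) :=
  ⟨fun ν _ => contDiffOn_besselK_div_rpow n ν, iteratedDeriv_besselK_div_rpow_isEquivalent hx n⟩
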